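/- Let $n\ge 0$ and let $\mathcal A=\bigoplus_{k\in\mathbb Z^n}\mathcal A^{(k)}$ be a unital complex $*$-algebra with a $\mathbb Z^n$-grading such that $(\mathcal A^{(k)})^*\subseteq\mathcal A^{(-k)}$ (equivalently, a comodule $*$-algebra over the Hopf $*$-algebra of the torus $\mathbb T^n$). Put $\delta_j(a)=k_ja$ for $a\in\mathcal A^{(k)}$, and let $\mathcal B=\mathcal A^{(0)}$ be the invariant subalgebra. A spectral triple $(\mathcal A,\mathcal H,D)$ is a unital $*$-representation of $\mathcal A$ by bounded operators on a complex Hilbert space $\mathcal H$ with a selfadjoint operator $D$ with compact resolvent such that every $a\in\mathcal A$ preserves $\mathrm{dom}\,D$ and has bounded commutator $[D,a]$. Let $(\mathcal A,\mathcal H,D,J)$ be an odd real spectral triple of $KR$-dimension $n+m$ ($m\in\mathbb Z$, $n+m$ odd): $J$ is antiunitary, $J^2=\epsilon$, $JD=\epsilon' DJ$ with $(\epsilon,\epsilon')=(+,-),(-,+),(-,-),(+,+)$ for $n+m\equiv 1,3,5,7 \pmod 8$, and $[a,Jb^*J^{-1}]=0$, $[[D,a],Jb^*J^{-1}]=0$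 for all $a,b\in\mathcal A$. Let it be $\mathbb T^n$-equivariant: there are given strongly commuting selfadjoint operators $\delta_1,\dots,\delta_n$ on $\mathcal H$, whose common domain $\bigcap_j\mathrm{dom}\,\delta_j$ is stable under $\mathcal A$, with $\delta_j(a\psi)=\delta_j(a)\psi+a\,\delta_j\psi$ there, $\delta_jJ+J\delta_j=0$, and with $D$ strongly commuting with each $\delta_j$. Let the triple be projectable, by means of a bounded operator $\Gamma=\Gamma^*$ with $\Gamma^2=1$ that commutes with $\mathcal A$ and with all $\delta_j$ and satisfies $J\Gamma=\Gamma J$ if $m\equiv 0\pmod 4$ and $J\Gamma=-\Gamma J$ otherwise. Define the horizontal Dirac operator, on the domain $\{\psi\in\mathrm{dom}\,D:\Gamma\psi\in\mathrm{dom}\,D\}$, by $$D_h=\tfrac12\Gamma\big(\Gamma D+(-1)^nD\Gamma\big),$$ that is, $D_h=\tfrac12\Gamma[\Gamma,D]_-$ for $n$ odd and $D_h=\tfrac12\Gamma[\Gamma,D]_+$ for $n$ even. Let $\mathcal H_0=\bigcap_j\ker\delta_j$. Assume that the fibres are isometric: there are an operator $D_v$ on $\mathcal H$ and bounded operators $Z,Z'$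 on $\mathcal H$, with $Z'$ selfadjoint, such that $D=D_v+D_h+Z$ as unbounded operators (with equality of domains), $D_v$ vanishes on $\mathcal H_0\cap\mathrm{dom}\,D_v$, $D_v\Gamma=(-1)^{n+1}\Gamma D_v$ on $\mathrm{dom}\,D_v$ (which $\Gamma$ preserves), $D_v$ commutes with each $\delta_j$ (that is, with its resolvents), $Z$ commutes with $\mathcal A$, and $Ja^*J^{-1}Z=Z'Ja^*J^{-1}$ for all $a\in\mathcal A$. Then the restrictions of $\mathcal B$, of $D_h$ and of $J$ to the Hilbert space $\mathcal H_0$ are well defined: $\mathcal B$ and $J$ preserve $\mathcal H_0$, and $D_h$ maps $\mathcal H_0\cap\mathrm{dom}\,D_h$ into $\mathcal H_0$. Let $D_0$, with domain $\mathcal H_0\cap\mathrm{dom}\,D_h$, be the restriction of $D_h$, and $J_0$ (an antiunitary operator on $\mathcal H_0$) that of $J$. Then $(\mathcal B,\mathcal H_0,D_0)$ is a spectral triple. Moreover $b^\circ h=J_0b^*J_0^{-1}h$ defines a $*$-representation of the opposite algebra $\mathcal B^\circ$ (a right action $hb$ of $\mathcal B$) on $\mathcal H_0$, and for all $b,c\in\mathcal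 B$: (a) $[b,J_0c^*J_0^{-1}]=0$, that is, $J_0$ maps $\mathcal B$ into its commutant; (b) $[[D_0,b],J_0c^*J_0^{-1}]=0$ (first-order condition). -/

import Mathlib

open scoped InnerProductSpace ComplexConjugate

noncomputable section

namespace TorusBundle

/-! ### Unbounded operators -/

section Operators

variable {H : Type*} [NormedAddCommGroup H] [InnerProductSpace ℂ H]

/-- The bounded operator `R` is the inverse of `T - z : dom T → H`. -/
def IsResolventAt (T : H →ₗ.[ℂ] H) (z : ℂ) (R : H →L[ℂ] H) : Prop :=
  (∀ x : H, ∃ h : R x ∈ T.domain, T ⟨R x, h⟩ - z • R x = x) ∧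
    ∀ y : T.domain, R (T y - z • (y : H)) = y

/-- `(T - z)⁻¹` exists and is a compact operator, for every non-real `z`. -/
def HasCompactResolvent (T : H →ₗ.[ℂ] H) : Prop :=
  ∀ z : ℂ, z.im ≠ 0 → ∃ R : H →L[ℂ] H, IsResolventAt T z R ∧ IsCompactOperator R

/-- The bounded operator `S` preserves `dom T`, and the bounded operator `X` agrees with the
commutator `T S - S T` on `dom T`.  If `T` is densely defined, `X` is unique, and it is the
operator denoted by `[T, S]`. -/
def IsCommutator (T : H →ₗ.[ℂ] H) (S X : H →L[ℂ] H) : Prop :=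
  ∀ ψ : T.domain, ∃ h : S ψ ∈ T.domain, X ψ = T ⟨S ψ, h⟩ - S (T ψ)

/-- `S T ⊆ c T S`: the bounded operator `S` preserves `dom T`, and `T S = c S T` on `dom T`.
For `c = 1` the operators commute, for `c = -1` they anticommute. -/
def CommutesUpTo (c : ℂ) (T : H →ₗ.[ℂ] H) (S : H →L[ℂ] H) : Prop :=
  ∀ ψ : T.domain, ∃ h : S ψ ∈ T.domain, T ⟨S ψ, h⟩ = c • S (T ψ)

/-- An operator `T` commutes with a self-adjoint operator `S` if it commutes with the resolvents
`(S - z)⁻¹`.  If `T` is self-adjoint as well, this is the usual (strong) commutation of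
self-adjoint operators, that is, commutation of their spectral projections. -/
def StronglyCommutes (T S : H →ₗ.[ℂ] H) : Prop :=
  ∀ (z : ℂ) (R : H →L[ℂ] H), z.im ≠ 0 → IsResolventAt S z R → CommutesUpTo 1 T R

/-- `T₀` is the restriction of `T` to the subspace `K`: its domain is `K ∩ dom T`, on which `T`
takes values in `K`. -/
def IsRestriction (K : Submodule ℂ H) (T : H →ₗ.[ℂ] H) (T₀ : K →ₗ.[ℂ] K) : Prop :=
  (∀ h : K, h ∈ T₀.domain ↔ (h : H) ∈ T.domain) ∧
    ∀ (h : T₀.domain) (h' : ((h : K) : H) ∈ T.domain), (T₀ h : H) = T ⟨((h : K) : H), h'⟩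

/-- The kernel of an unbounded operator, as a subspace of the whole space. -/
def kernel (T : H →ₗ.[ℂ] H) : Submodule ℂ H where
  carrier := {ψ | ∃ h : ψ ∈ T.domain, T ⟨ψ, h⟩ = 0}
  zero_mem' := ⟨T.domain.zero_mem, T.map_zero⟩
  add_mem' := by
    rintro x y ⟨hx, hx'⟩ ⟨hy, hy'⟩
    refine ⟨T.domain.add_mem hx hy, ?_⟩
    have := T.map_add ⟨x, hx⟩ ⟨y, hy⟩
    rw [hx', hy', add_zero] at this
    exact this
  smul_mem' := by
    rintro c x ⟨hx, hx'⟩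
    refine ⟨T.domain.smul_mem c hx, ?_⟩
    have := T.map_smul c ⟨x, hx⟩
    rw [hx', smul_zero] at this
    exact this

theorem isClosed_kernel [CompleteSpace H] {T : H →ₗ.[ℂ] H} (hT : IsSelfAdjoint T) :
    IsClosed (kernel T : Set H) := by
  have hd := hT.dense_domain
  have hadj : T.adjoint = T := hT
  have key : (kernel T : Set H) = ⋂ x : T.domain, {ψ : H | inner ℂ ψ (T x) = 0} := by
    ext ψ
    simp only [Set.mem_iInter, Set.mem_ofPred_eq]
    constructor
    · rintro ⟨h, h0⟩ x
      have hf : T.IsFormalAdjoint T := by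
        have := LinearPMap.adjoint_isFormalAdjoint hd
        rwa [hadj] at this
      have := hf ⟨ψ, h⟩ x
      rw [h0, inner_zero_left] at this
      exact this.symm
    · intro h
      have h1 : ψ ∈ T.adjoint.domain :=
        LinearPMap.mem_adjoint_domain_of_exists ψ ⟨0, fun x => by rw [inner_zero_left, h x]⟩
      have h2 : T.adjoint ⟨ψ, h1⟩ = 0 :=
        LinearPMap.adjoint_apply_eq hd ⟨ψ, h1⟩ (fun x => by rw [inner_zero_left, h x])
      have h3 : ψ ∈ kernel T.adjoint := ⟨h1, h2⟩
      rw [hadj] at h3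
      exact h3
  rw [key]
  exact isClosed_iInter fun x => isClosed_eq (by fun_prop) continuous_const

end Operators

/-! ### Real spectral triples -/

section Triples

variable {A : Type*} [Ring A] [StarRing A] [Algebra ℂ A]
variable {H : Type*} [NormedAddCommGroup H] [InnerProductSpace ℂ H] [CompleteSpace H]

variable (A H) in
/-- A spectral triple `(A, H, D)` over a unital complex `*`-algebra `A`, represented on the
Hilbert space `H` by bounded operators. -/
structure SpectralTriple where
  /-- the representation of the algebra -/
  π : A →⋆ₐ[ℂ] (H →L[ℂ] H)
  /-- the Dirac operator -/
  D : H →ₗ.[ℂ] H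
  isSelfAdjoint : IsSelfAdjoint D
  hasCompactResolvent : HasCompactResolvent D
  /-- all commutators `[D, a]` are bounded -/
  bounded_commutator : ∀ a : A, ∃ X : H →L[ℂ] H, IsCommutator D (π a) X

/-- The operator `J b* J⁻¹`. -/
def oppositeAction (π : A →⋆ₐ[ℂ] (H →L[ℂ] H)) (J : H ≃ₗᵢ⋆[ℂ] H) (b : A) : H →L[ℂ] H :=
  (J.toContinuousLinearEquiv : H →SL[conj] H).comp
    ((π (star b)).comp (J.symm.toContinuousLinearEquiv : H →SL[conj] H))

@[simp]
theorem oppositeAction_apply (π : A →⋆ₐ[ℂ] (H →L[ℂ] H)) (J : H ≃ₗᵢ⋆[ℂ] H) (b : A) (ψ : H) :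
    oppositeAction π J b ψ = J (π (star b) (J.symm ψ)) := rfl

/-- The sign `ε` in `J² = ε` for odd `KR`-dimension `d`. -/
def signJSq (d : ℤ) : ℂ := if d ≡ 1 [ZMOD 8] ∨ d ≡ 7 [ZMOD 8] then 1 else -1

/-- The sign `ε'` in `J D = ε' D J` for odd `KR`-dimension `d`. -/
def signJD (d : ℤ) : ℂ := if d ≡ 3 [ZMOD 8] ∨ d ≡ 7 [ZMOD 8] then 1 else -1

variable (A H) in
/-- An odd real spectral triple `(A, H, D, J)` of `KR`-dimension `d`. -/
structure OddRealSpectralTriple (d : ℤ) extends SpectralTriple A H where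
  odd_dim : Odd d
  /-- the real structure -/
  J : H ≃ₗᵢ⋆[ℂ] H
  J_sq : ∀ ψ : H, J (J ψ) = signJSq d • ψ
  J_D : ∀ ψ : D.domain, ∃ h : J ψ ∈ D.domain, J (D ψ) = signJD d • D ⟨J ψ, h⟩
  /-- the adjoint action of `J` maps the algebra into its commutant -/
  commutant : ∀ a b : A, Commute (π a) (oppositeAction π J b)
  /-- `[[D, a], J b* J⁻¹] = 0` -/
  first_order : ∀ (a b : A) (X : H →L[ℂ] H), IsCommutator D (π a) X →
    Commute X (oppositeAction π J b)

end Triples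

/-! ### Torus actions -/

section Grading

variable {A : Type*} [Ring A] [Algebra ℂ A] {n : ℕ}

/-- A `ℤⁿ`-grading of a `*`-algebra is compatible with the involution if `*` maps the part of
degree `k` into the part of degree `-k`.  A `ℤⁿ`-graded `*`-algebra of this kind is the same as a
comodule `*`-algebra over the Hopf `*`-algebra of the torus `Tⁿ`, the part of degree `k` being
`{a | Δ a = a ⊗ z ^ k}`. -/
class StarCompatible [StarRing A] (𝒜 : (Fin n → ℤ) → Submodule ℂ A) : Prop where
  star_mem : ∀ {k : Fin n → ℤ} {a : A}, a ∈ 𝒜 k → star a ∈ 𝒜 (-k)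

variable (𝒜 : (Fin n → ℤ) → Submodule ℂ A) [GradedAlgebra 𝒜]

/-- The derivation `δ_j` of the algebra: multiplication by `k j` in degree `k`. -/
def derivation (j : Fin n) : A →ₗ[ℂ] A :=
  (DirectSum.toModule ℂ (Fin n → ℤ) A fun k => ((k j : ℤ) : ℂ) • (𝒜 k).subtype).comp
    (DirectSum.decomposeLinearEquiv 𝒜).toLinearMap

theorem derivation_of_mem (j : Fin n) {k : Fin n → ℤ} {a : A} (ha : a ∈ 𝒜 k) :
    derivation 𝒜 j a = ((k j : ℤ) : ℂ) • a := by
  simp only [derivation, LinearMap.comp_apply, LinearEquiv.coe_coe,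
    DirectSum.decomposeLinearEquiv_apply, DirectSum.decompose_of_mem 𝒜 ha]
  erw [DirectSum.toModule_lof]
  simp

/-- The invariant subalgebra `B`, that is, the part of degree `0`. -/
def invariantSubalgebra [StarRing A] [StarModule ℂ A] [StarCompatible 𝒜] : StarSubalgebra ℂ A where
  carrier := 𝒜 0
  mul_mem' {a b} ha hb := by
    have := SetLike.mul_mem_graded (A := 𝒜) ha hb
    rwa [add_zero] at this
  add_mem' ha hb := (𝒜 0).add_mem ha hb
  algebraMap_mem' r := SetLike.algebraMap_mem_graded 𝒜 r
  star_mem' {a} ha := by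
    have : star a ∈ 𝒜 (-0) := StarCompatible.star_mem ha
    rwa [neg_zero] at this

end Grading

section Equivariant

variable {A : Type*} [Ring A] [StarRing A] [Algebra ℂ A] {n : ℕ}
variable (𝒜 : (Fin n → ℤ) → Submodule ℂ A) [GradedAlgebra 𝒜]
variable (H : Type*) [NormedAddCommGroup H] [InnerProductSpace ℂ H] [CompleteSpace H]

/-- An odd `Tⁿ`-equivariant real spectral triple `(A, H, D, J, δ)` of `KR`-dimension `d`. -/
structure EquivariantTriple (d : ℤ) extends OddRealSpectralTriple A H d where
  /-- the generators of the torus action on the Hilbert space -/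
  δ : Fin n → (H →ₗ.[ℂ] H)
  δ_isSelfAdjoint : ∀ j, IsSelfAdjoint (δ j)
  δ_commute : ∀ i j, StronglyCommutes (δ i) (δ j)
  /-- the common domain of the `δ j` is stable under the algebra, and
  `δ_j (a ψ) = δ_j(a) ψ + a δ_j(ψ)` on it -/
  δ_leibniz : ∀ (a : A) (ψ : H) (hψ : ∀ i, ψ ∈ (δ i).domain) (j : Fin n),
    ∃ h : π a ψ ∈ (δ j).domain,
      δ j ⟨π a ψ, h⟩ = π (derivation 𝒜 j a) ψ + π a (δ j ⟨ψ, hψ j⟩)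
  δ_J : ∀ (j : Fin n) (ψ : (δ j).domain), ∃ h : J ψ ∈ (δ j).domain,
    δ j ⟨J ψ, h⟩ + J (δ j ψ) = 0
  δ_D : ∀ j, StronglyCommutes D (δ j)

namespace EquivariantTriple

variable {𝒜 H} {d : ℤ} (T : EquivariantTriple 𝒜 H d)

/-- The common `0`-eigenspace `H₀` of the operators `δ j`. -/
def zeroEigenspace : Submodule ℂ H := ⨅ j, kernel (T.δ j)

theorem isClosed_zeroEigenspace : IsClosed (T.zeroEigenspace : Set H) := by
  rw [zeroEigenspace, Submodule.coe_iInf]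
  exact isClosed_iInter fun j => isClosed_kernel (T.δ_isSelfAdjoint j)

instance : CompleteSpace T.zeroEigenspace :=
  T.isClosed_zeroEigenspace.completeSpace_coe

end EquivariantTriple

/-! ### Projectability and isometric fibres -/

variable {H}

/-- `½ Γ (Γ D + (-1)ⁿ D Γ)` on its natural domain `{ψ ∈ dom D | Γ ψ ∈ dom D}`.  For `Γ² = 1` it
is the part of `D` that anticommutes (`n` odd) or commutes (`n` even) with `Γ`. -/
def horizontalOperator (n : ℕ) (D : H →ₗ.[ℂ] H) (Γ : H →L[ℂ] H) : H →ₗ.[ℂ] H where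
  domain := D.domain ⊓ D.domain.comap (Γ : H →ₗ[ℂ] H)
  toFun :=
    { toFun := fun ψ => (1 / 2 : ℂ) •
        Γ (Γ (D ⟨(ψ : H), ψ.2.1⟩) + (-1 : ℂ) ^ n • D ⟨Γ (ψ : H), ψ.2.2⟩)
      map_add' := fun x y => by
        have h1 := D.map_add ⟨(x : H), x.2.1⟩ ⟨(y : H), y.2.1⟩
        have h2 := D.map_add ⟨Γ (x : H), x.2.2⟩ ⟨Γ (y : H), y.2.2⟩
        have h3 : D ⟨((x + y : ↥(D.domain ⊓ D.domain.comap (Γ : H →ₗ[ℂ] H))) : H), (x + y).2.1⟩ =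
            D ⟨(x : H), x.2.1⟩ + D ⟨(y : H), y.2.1⟩ := h1
        have h4 : D ⟨Γ ((x + y : ↥(D.domain ⊓ D.domain.comap (Γ : H →ₗ[ℂ] H))) : H),
            (x + y).2.2⟩ = D ⟨Γ (x : H), x.2.2⟩ + D ⟨Γ (y : H), y.2.2⟩ := by
          rw [← h2]
          congr 1
          exact Subtype.ext (map_add Γ _ _)
        rw [h3, h4]
        simp only [map_add, smul_add]
        abel
      map_smul' := fun c x => by
        have h1 := D.map_smul c ⟨(x : H), x.2.1⟩
        have h2 := D.map_smul c ⟨Γ (x : H), x.2.2⟩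
        have h3 : D ⟨((c • x : ↥(D.domain ⊓ D.domain.comap (Γ : H →ₗ[ℂ] H))) : H), (c • x).2.1⟩ =
            c • D ⟨(x : H), x.2.1⟩ := h1
        have h4 : D ⟨Γ ((c • x : ↥(D.domain ⊓ D.domain.comap (Γ : H →ₗ[ℂ] H))) : H),
            (c • x).2.2⟩ = c • D ⟨Γ (x : H), x.2.2⟩ := by
          rw [← h2]
          congr 1
          exact Subtype.ext (map_smul Γ _ _)
        rw [h3, h4]
        simp only [map_add, map_smul, RingHom.id_apply, smul_add, smul_comm c] }

variable {𝒜}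

/-- `Γ` makes the triple, of `KR`-dimension `n + m`, projectable along the fibres. -/
structure IsProjectable {m : ℤ} (T : EquivariantTriple 𝒜 H (n + m)) (Γ : H →L[ℂ] H) : Prop where
  sq : Γ * Γ = 1
  isSelfAdjoint : IsSelfAdjoint Γ
  comm_algebra : ∀ a : A, Commute Γ (T.π a)
  comm_δ : ∀ j : Fin n, CommutesUpTo 1 (T.δ j) Γ
  J_comm : m ≡ 0 [ZMOD 4] → ∀ ψ : H, T.J (Γ ψ) = Γ (T.J ψ)
  J_anticomm : ¬ m ≡ 0 [ZMOD 4] → ∀ ψ : H, T.J (Γ ψ) = -Γ (T.J ψ)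

/-- The horizontal Dirac operator `D_h`. -/
def EquivariantTriple.horizontalDirac {d : ℤ} (T : EquivariantTriple 𝒜 H d) (Γ : H →L[ℂ] H) :
    H →ₗ.[ℂ] H :=
  horizontalOperator n T.D Γ

/-- The isometric fibres condition: `D = D_v + D_h + Z` (an equality of unbounded operators, with
the natural domain of the sum), where `D_v`, `Z` and `Z'` have the listed properties. -/
def HasIsometricFibres {d : ℤ} (T : EquivariantTriple 𝒜 H d) (Γ : H →L[ℂ] H) : Prop :=
  ∃ (Dv : H →ₗ.[ℂ] H) (Z Z' : H →L[ℂ] H),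
    T.D = Dv + T.horizontalDirac Γ + (Z : H →ₗ[ℂ] H).toPMap ⊤ ∧
    (∀ ψ : Dv.domain, (ψ : H) ∈ T.zeroEigenspace → Dv ψ = 0) ∧
    CommutesUpTo ((-1) ^ (n + 1)) Dv Γ ∧
    (∀ j, StronglyCommutes Dv (T.δ j)) ∧
    (∀ a : A, Commute Z (T.π a)) ∧
    IsSelfAdjoint Z' ∧
    ∀ (a : A) (ψ : H), oppositeAction T.π T.J a (Z ψ) = Z' (oppositeAction T.π T.J a ψ)

end Equivariant

end TorusBundle

end

/-!
Since `D` commutes strongly with the `δ_j`, its resolvents preserve `H₀ = ⋂ ker δ_j`, and since the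
resolvents at `z` and at `conj z` are adjoint to each other, `H₀` reduces `D`.  Hence `D|H₀` is
self-adjoint with compact resolvent and yields a spectral triple over `B`, which inherits the
commutant property and the first-order condition from `H`.

On `H₀` the vertical part `D_v` vanishes, so that `D_h = D - Z` there.  As the difference of two
operators that map `H₀` to itself, `Z` preserves `H₀`; as the difference of two symmetric operators
with a common dense domain, it is self-adjoint on `H₀`, although it need not be self-adjoint on `H`.
So `D_h|H₀` is a bounded self-adjoint perturbation of `D|H₀`, by an operator that commutes with `B`:
it is again self-adjoint with compact resolvent, by the resolvent identity, and it has the same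
commutators with `B` as `D|H₀`.
-/

noncomputable section

namespace TorusBundle

section Symmetric

variable {H : Type*} [NormedAddCommGroup H] [InnerProductSpace ℂ H] {T : H →ₗ.[ℂ] H} {z : ℂ}

/-- The operator `T - z`, as a linear map on the domain of `T`. -/
def subSMul (T : H →ₗ.[ℂ] H) (z : ℂ) : T.domain →ₗ[ℂ] H :=
  T.toFun - z • T.domain.subtype

theorem subSMul_apply (T : H →ₗ.[ℂ] H) (z : ℂ) (x : T.domain) :
    subSMul T z x = T x - z • (x : H) := rfl

theorem im_inner_apply_self (hT : T.IsFormalAdjoint T) (x : T.domain) :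
    (⟪(x : H), T x⟫_ℂ).im = 0 := by
  refine Complex.conj_eq_iff_im.mp ?_
  rw [inner_conj_symm]
  exact hT x x

theorem im_inner_subSMul_self (hT : T.IsFormalAdjoint T) (z : ℂ) (x : T.domain) :
    (⟪(x : H), subSMul T z x⟫_ℂ).im = -(z.im * ‖(x : H)‖ ^ 2) := by
  have hself : ⟪(x : H), (x : H)⟫_ℂ = ((‖(x : H)‖ ^ 2 : ℝ) : ℂ) := by
    rw [inner_self_eq_norm_sq_to_K, Complex.ofReal_pow]
    rfl
  rw [subSMul_apply, inner_sub_right, inner_smul_right, hself, Complex.sub_im,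
    im_inner_apply_self hT, Complex.im_mul_ofReal, zero_sub]

theorem abs_im_mul_norm_le_norm_subSMul (hT : T.IsFormalAdjoint T) (z : ℂ) (x : T.domain) :
    |z.im| * ‖(x : H)‖ ≤ ‖subSMul T z x‖ := by
  have hsq : |z.im| * ‖(x : H)‖ * ‖(x : H)‖ ≤ ‖subSMul T z x‖ * ‖(x : H)‖ :=
    calc |z.im| * ‖(x : H)‖ * ‖(x : H)‖ = |(⟪(x : H), subSMul T z x⟫_ℂ).im| := by
          rw [im_inner_subSMul_self hT, abs_neg, abs_mul, abs_of_nonneg (sq_nonneg ‖(x : H)‖), sq,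
            mul_assoc]
      _ ≤ ‖⟪(x : H), subSMul T z x⟫_ℂ‖ := Complex.abs_im_le_norm _
      _ ≤ ‖subSMul T z x‖ * ‖(x : H)‖ := by
          rw [mul_comm]
          exact norm_inner_le_norm _ _
  rcases (norm_nonneg (x : H)).eq_or_lt with hx | hx
  · rw [← hx, mul_zero]
    exact norm_nonneg _
  · exact le_of_mul_le_mul_right hsq hx

theorem subSMul_injective (hT : T.IsFormalAdjoint T) (hz : z.im ≠ 0) :
    Function.Injective (subSMul T z) := by
  refine (injective_iff_map_eq_zero _).mpr fun x hx => ?_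
  have h := abs_im_mul_norm_le_norm_subSMul hT z x
  rw [hx, norm_zero] at h
  exact Subtype.ext (norm_le_zero_iff.mp (nonpos_of_mul_nonpos_right h (abs_pos.mpr hz)))

theorem norm_graph_le_norm_subSMul (hT : T.IsFormalAdjoint T) (hz : z.im ≠ 0) (x : T.domain) :
    ‖((x : H), T x)‖ ≤ (1 + (1 + ‖z‖) / |z.im|) * ‖subSMul T z x‖ := by
  have hx : ‖(x : H)‖ ≤ ‖subSMul T z x‖ / |z.im| := by
    rw [le_div_iff₀' (abs_pos.mpr hz)]
    exact abs_im_mul_norm_le_norm_subSMul hT z x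
  have hTx : ‖T x‖ ≤ ‖subSMul T z x‖ + ‖z‖ * ‖(x : H)‖ := by
    rw [← norm_smul]
    simpa only [subSMul_apply, sub_add_cancel] using norm_add_le (subSMul T z x) (z • (x : H))
  calc ‖((x : H), T x)‖ ≤ ‖(x : H)‖ + ‖T x‖ := max_le_add_of_nonneg (norm_nonneg _) (norm_nonneg _)
    _ ≤ ‖subSMul T z x‖ + (1 + ‖z‖) * ‖(x : H)‖ := by linarith
    _ ≤ ‖subSMul T z x‖ + (1 + ‖z‖) * (‖subSMul T z x‖ / |z.im|) := by gcongr
    _ = (1 + (1 + ‖z‖) / |z.im|) * ‖subSMul T z x‖ := by ring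

theorem isClosed_range_subSMul [CompleteSpace H] (hT : T.IsFormalAdjoint T) (hcl : T.IsClosed)
    (hz : z.im ≠ 0) : IsClosed ((subSMul T z).range : Set H) := by
  have hcl' : IsClosed (T.graph : Set (H × H)) := hcl
  have : CompleteSpace T.graph := hcl'.completeSpace_coe
  let f : T.graph →L[ℂ] H :=
    (ContinuousLinearMap.snd ℂ H H - z • ContinuousLinearMap.fst ℂ H H).comp T.graph.subtypeL
  have hgraph (p : T.graph) :
      ∃ x : T.domain, (p : H × H) = ((x : H), T x) ∧ f p = subSMul T z x := by
    obtain ⟨⟨u, v⟩, hp⟩ := p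
    obtain ⟨x, rfl, rfl⟩ := T.mem_graph_iff.mp hp
    exact ⟨x, rfl, rfl⟩
  have hf : AntilipschitzWith (Real.toNNReal (1 + (1 + ‖z‖) / |z.im|)) f := by
    refine AddMonoidHomClass.antilipschitz_of_bound f fun p => ?_
    obtain ⟨x, hp, hfp⟩ := hgraph p
    rw [Real.coe_toNNReal _ (by positivity), hfp, Submodule.coe_norm, hp]
    exact norm_graph_le_norm_subSMul hT hz x
  have hrange : ((subSMul T z).range : Set H) = Set.range f := by
    refine Set.Subset.antisymm ?_ ?_
    · rintro _ ⟨x, rfl⟩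
      exact ⟨⟨_, T.mem_graph x⟩, rfl⟩
    · rintro _ ⟨p, rfl⟩
      obtain ⟨x, -, hfp⟩ := hgraph p
      exact ⟨x, hfp.symm⟩
  rw [hrange]
  exact hf.isClosed_range f.uniformContinuous

end Symmetric

section SelfAdjoint

variable {H : Type*} [NormedAddCommGroup H] [InnerProductSpace ℂ H] [CompleteSpace H]
variable {T : H →ₗ.[ℂ] H} {z : ℂ}

theorem isFormalAdjoint_self (hT : IsSelfAdjoint T) : T.IsFormalAdjoint T := by
  have h := LinearPMap.adjoint_isFormalAdjoint hT.dense_domain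
  rwa [LinearPMap.isSelfAdjoint_def.mp hT] at h

theorem exists_apply_eq_of_forall_inner_eq (hT : IsSelfAdjoint T) {y w : H}
    (h : ∀ x : T.domain, ⟪w, x⟫_ℂ = ⟪y, T x⟫_ℂ) : ∃ hy : y ∈ T.domain, T ⟨y, hy⟩ = w := by
  have hadj : ∃ hy : y ∈ T.adjoint.domain, T.adjoint ⟨y, hy⟩ = w :=
    ⟨LinearPMap.mem_adjoint_domain_of_exists y ⟨w, h⟩,
      LinearPMap.adjoint_apply_eq hT.dense_domain _ h⟩
  rwa [LinearPMap.isSelfAdjoint_def.mp hT] at hadj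

theorem isSelfAdjoint_of_forall_mem_domain (hd : Dense (T.domain : Set H))
    (hT : T.IsFormalAdjoint T)
    (h : ∀ y w : H, (∀ x : T.domain, ⟪w, x⟫_ℂ = ⟪y, T x⟫_ℂ) → y ∈ T.domain) :
    IsSelfAdjoint T := by
  have hle : T ≤ T.adjoint := hT.le_adjoint hd
  refine (LinearPMap.eq_of_le_of_domain_eq hle (le_antisymm hle.1 fun y hy => ?_)).symm
  exact h y (T.adjoint ⟨y, hy⟩) (LinearPMap.adjoint_isFormalAdjoint hd ⟨y, hy⟩)

theorem subSMul_surjective (hT : IsSelfAdjoint T) (hz : z.im ≠ 0) :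
    Function.Surjective (subSMul T z) := by
  have hs := isFormalAdjoint_self hT
  have : CompleteSpace (subSMul T z).range :=
    (isClosed_range_subSMul hs hT.isClosed hz).completeSpace_coe
  rw [← LinearMap.range_eq_top, ← Submodule.orthogonal_eq_bot_iff, Submodule.eq_bot_iff]
  intro y hy
  -- the orthogonal complement of the range of `T - z` is the kernel of `T - conj z`
  obtain ⟨hy', hTy⟩ := exists_apply_eq_of_forall_inner_eq hT (y := y) (w := conj z • y) fun x => by
    have h := (Submodule.mem_orthogonal' _ _).mp hy _ ⟨x, rfl⟩
    rw [subSMul_apply, inner_sub_right, sub_eq_zero, inner_smul_right] at h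
    rw [inner_smul_left, Complex.conj_conj, h]
  have hker : subSMul T (conj z) ⟨y, hy'⟩ = subSMul T (conj z) 0 := by
    rw [subSMul_apply, hTy, sub_self, map_zero]
  exact congrArg Subtype.val (subSMul_injective hs (by simpa using hz) hker)

theorem exists_isResolventAt (hT : IsSelfAdjoint T) (hz : z.im ≠ 0) :
    ∃ R : H →L[ℂ] H, IsResolventAt T z R := by
  have hs := isFormalAdjoint_self hT
  let e := LinearEquiv.ofBijective (subSMul T z) ⟨subSMul_injective hs hz, subSMul_surjective hT hz⟩
  have he (x : H) : subSMul T z (e.symm x) = x := e.apply_symm_apply x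
  have hbound (x : H) : ‖(e.symm x : H)‖ ≤ |z.im|⁻¹ * ‖x‖ := by
    rw [le_inv_mul_iff₀ (abs_pos.mpr hz)]
    simpa only [he] using abs_im_mul_norm_le_norm_subSMul hs z (e.symm x)
  exact ⟨(T.domain.subtype ∘ₗ e.symm.toLinearMap).mkContinuous _ hbound,
    fun x => ⟨(e.symm x).2, he x⟩, fun y => congrArg Subtype.val (e.symm_apply_apply y)⟩

end SelfAdjoint

section Commutation

variable {H : Type*} [NormedAddCommGroup H] [InnerProductSpace ℂ H]
variable {D S T : H →ₗ.[ℂ] H} {X Q : H →L[ℂ] H} {c z : ℂ}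

theorem CommutesUpTo.apply_mem_kernel (h : CommutesUpTo c T X) {x : H} (hx : x ∈ kernel T) :
    X x ∈ kernel T := by
  obtain ⟨hx, hTx⟩ := hx
  obtain ⟨hXx, hTXx⟩ := h ⟨x, hx⟩
  exact ⟨hXx, by rw [hTXx, hTx, map_zero, smul_zero]⟩

theorem IsResolventAt.commutesUpTo_one_iff (hQ : IsResolventAt T z Q) :
    CommutesUpTo 1 T X ↔ Commute Q X := by
  refine ⟨fun h => ContinuousLinearMap.ext fun x => ?_, fun h ψ => ?_⟩
  · obtain ⟨hQx, hx⟩ := hQ.1 x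
    obtain ⟨hXQx, hTX⟩ := h ⟨Q x, hQx⟩
    have hQTX := hQ.2 ⟨X (Q x), hXQx⟩
    rwa [hTX, one_smul, ← map_smul, ← map_sub, hx] at hQTX
  · have hψ : Q (X (T ψ - z • (ψ : H))) = X ψ :=
      (DFunLike.congr_fun h.eq _).trans (congrArg X (hQ.2 ψ))
    obtain ⟨hmem, hT⟩ := hQ.1 (X (T ψ - z • (ψ : H)))
    simp only [hψ] at hmem hT
    refine ⟨hmem, ?_⟩
    rw [one_smul]
    exact sub_left_injective (hT.trans (by rw [map_sub, map_smul]))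

theorem IsResolventAt.adjoint_eq [CompleteSpace H] (hT : T.IsFormalAdjoint T)
    {R : H →L[ℂ] H} (hQ : IsResolventAt T z Q) (hR : IsResolventAt T (conj z) R) :
    Q.adjoint = R := by
  refine ((ContinuousLinearMap.eq_adjoint_iff _ _).mpr fun x y => ?_).symm
  obtain ⟨hRx, hx⟩ := hR.1 x
  obtain ⟨hQy, hy⟩ := hQ.1 y
  calc ⟪R x, y⟫_ℂ = ⟪R x, T ⟨Q y, hQy⟩ - z • Q y⟫_ℂ := by rw [hy]
    _ = ⟪T ⟨R x, hRx⟩ - conj z • R x, Q y⟫_ℂ := by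
      rw [inner_sub_left, inner_sub_right, inner_smul_left, inner_smul_right, Complex.conj_conj,
        hT ⟨R x, hRx⟩ ⟨Q y, hQy⟩]
    _ = ⟪x, Q y⟫_ℂ := by rw [hx]

theorem StronglyCommutes.commutesUpTo_resolvent [CompleteSpace H] (h : StronglyCommutes D S)
    (hS : IsSelfAdjoint S) (hQ : IsResolventAt D z Q) : CommutesUpTo 1 S Q := by
  have hI : Complex.I.im ≠ 0 := by simp
  obtain ⟨R, hR⟩ := exists_isResolventAt hS hI
  exact hR.commutesUpTo_one_iff.mpr (hQ.commutesUpTo_one_iff.mp (h _ R hI hR)).symm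

theorem IsCommutator.unique (hT : Dense (T.domain : Set H)) {Y Y' : H →L[ℂ] H}
    (hY : IsCommutator T X Y) (hY' : IsCommutator T X Y') : Y = Y' := by
  refine DFunLike.coe_injective (Y.continuous.ext_on hT Y'.continuous fun x hx => ?_)
  obtain ⟨_, h⟩ := hY ⟨x, hx⟩
  obtain ⟨_, h'⟩ := hY' ⟨x, hx⟩
  exact h.trans h'.symm

theorem isCommutator_vadd_iff {V Y : H →L[ℂ] H} (h : Commute V X) :
    IsCommutator ((V : H →ₗ[ℂ] H) +ᵥ T) X Y ↔ IsCommutator T X Y := by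
  refine forall_congr' fun x => exists_congr fun hx => ?_
  have hVX : V (X x) = X (V x) := DFunLike.congr_fun h.eq (x : H)
  change Y x = V (X x) + T ⟨X x, hx⟩ - X (V x + T x) ↔ _
  rw [hVX, map_add, add_sub_add_left_eq_sub]

end Commutation

section BoundedPerturbation

variable {H : Type*} [NormedAddCommGroup H] [InnerProductSpace ℂ H] [CompleteSpace H]
variable {T : H →ₗ.[ℂ] H} {V : H →L[ℂ] H}

theorem isSelfAdjoint_vadd (hV : IsSelfAdjoint V) (hT : IsSelfAdjoint T) :
    IsSelfAdjoint ((V : H →ₗ[ℂ] H) +ᵥ T) := by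
  have hsymm (x y : H) : ⟪V x, y⟫_ℂ = ⟪x, V y⟫_ℂ := hV.isSymmetric x y
  refine isSelfAdjoint_of_forall_mem_domain hT.dense_domain (fun x y => ?_) fun y w h => ?_
  · change ⟪V x + T x, (y : H)⟫_ℂ = ⟪(x : H), V y + T y⟫_ℂ
    rw [inner_add_left, inner_add_right, hsymm, isFormalAdjoint_self hT x y]
  · refine (exists_apply_eq_of_forall_inner_eq hT (y := y) (w := w - V y) fun x => ?_).1
    have hx : ⟪w, (x : H)⟫_ℂ = ⟪y, V x + T x⟫_ℂ := h x
    rw [inner_sub_left, hx, hsymm, inner_add_right, add_sub_cancel_left]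

theorem hasCompactResolvent_vadd (hV : IsSelfAdjoint V) (hT : IsSelfAdjoint T)
    (hTc : HasCompactResolvent T) : HasCompactResolvent ((V : H →ₗ[ℂ] H) +ᵥ T) := by
  intro z hz
  obtain ⟨R, hR, hRc⟩ := hTc z hz
  obtain ⟨Q, hQ⟩ := exists_isResolventAt (isSelfAdjoint_vadd hV hT) hz
  have resolvent_identity : Q = R ∘L (1 - V ∘L Q) := by
    ext x
    obtain ⟨hQx, hx⟩ := hQ.1 x
    replace hx : V (Q x) + T ⟨Q x, hQx⟩ - z • Q x = x := hx
    have hsub : T ⟨Q x, hQx⟩ - z • Q x = x - V (Q x) := by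
      nth_rewrite 3 [← hx]
      abel
    exact (hR.2 ⟨Q x, hQx⟩).symm.trans (congrArg R hsub)
  refine ⟨Q, hQ, ?_⟩
  rw [resolvent_identity]
  exact hRc.comp_clm _

end BoundedPerturbation

section Reduction

variable {H : Type*} [NormedAddCommGroup H] [InnerProductSpace ℂ H]
variable {K : Submodule ℂ H} {T : H →ₗ.[ℂ] H}

/-- The closed subspace `K` reduces the unbounded operator `T`: the orthogonal projection onto `K`
preserves the domain of `T` and commutes with `T` there.  Both `K` and its orthogonal complement
are then invariant under `T`, and `T` is the direct sum of its restrictions to them. -/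
def Reduces (K : Submodule ℂ H) [K.HasOrthogonalProjection] (T : H →ₗ.[ℂ] H) : Prop :=
  CommutesUpTo 1 T K.starProjection

/-- The restriction of an unbounded operator to an invariant subspace `K`, as an operator in `K`
with domain `K ∩ dom T`. -/
def restriction (K : Submodule ℂ H) (T : H →ₗ.[ℂ] H)
    (hK : ∀ x : T.domain, (x : H) ∈ K → T x ∈ K) : K →ₗ.[ℂ] K where
  domain := T.domain.comap K.subtype
  toFun :=
    { toFun := fun x => ⟨T ⟨x, x.2⟩, hK _ x.1.2⟩
      map_add' := fun x y => Subtype.ext (T.map_add ⟨x, x.2⟩ ⟨y, y.2⟩)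
      map_smul' := fun c x => Subtype.ext (T.map_smul c ⟨x, x.2⟩) }

theorem dense_comap_subtype_of_starProjection_mem [K.HasOrthogonalProjection] {L : Submodule ℂ H}
    (hL : Dense (L : Set H)) (h : ∀ x ∈ L, K.starProjection x ∈ L) :
    Dense (L.comap K.subtype : Set K) := by
  have hsurj : Function.Surjective K.orthogonalProjectionOnto := fun x =>
    ⟨x, K.orthogonalProjectionOnto_mem_subspace_eq_self x⟩
  refine (hsurj.denseRange.dense_image K.orthogonalProjectionOnto.continuous hL).mono ?_
  rintro _ ⟨x, hx, rfl⟩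
  exact h x hx

theorem apply_mem_of_dense (hK : IsClosed (K : Set H)) {L : Submodule ℂ H}
    (hL : Dense (L.comap K.subtype : Set K)) (X : H →L[ℂ] H) (h : ∀ x ∈ L, x ∈ K → X x ∈ K) {x : H}
    (hx : x ∈ K) : X x ∈ K := by
  have hclosed : IsClosed {y : K | X y ∈ K} := hK.preimage (by fun_prop)
  exact closure_minimal (fun (y : K) hy => h y hy y.2) hclosed (hL ⟨x, hx⟩)

theorem isSelfAdjoint_of_forall_inner_eq_of_dense {E : Type*} [NormedAddCommGroup E]
    [InnerProductSpace ℂ E] [CompleteSpace E] {L : Set E} (hL : Dense L) {V : E →L[ℂ] E}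
    (h : ∀ x ∈ L, ∀ y ∈ L, ⟪V x, y⟫_ℂ = ⟪x, V y⟫_ℂ) : IsSelfAdjoint V := by
  refine ContinuousLinearMap.isSelfAdjoint_iff_isSymmetric.mpr fun x y => ?_
  have hclosed : IsClosed {p : E × E | ⟪V p.1, p.2⟫_ℂ = ⟪p.1, V p.2⟫_ℂ} :=
    isClosed_eq (by fun_prop) (by fun_prop)
  exact closure_minimal (fun p hp => h p.1 hp.1 p.2 hp.2) hclosed ((hL.prod hL) (x, y))

namespace Reduces

theorem of_resolvent_mem [CompleteSpace H] [K.HasOrthogonalProjection] (hT : IsSelfAdjoint T)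
    (h : ∀ (z : ℂ) (R : H →L[ℂ] H), z.im ≠ 0 → IsResolventAt T z R → ∀ x ∈ K, R x ∈ K) :
    Reduces K T := by
  have hI : Complex.I.im ≠ 0 := by simp
  have hI' : (conj Complex.I).im ≠ 0 := by simp
  obtain ⟨Q, hQ⟩ := exists_isResolventAt hT hI
  obtain ⟨R, hR⟩ := exists_isResolventAt hT hI'
  have horthogonal : ∀ x ∈ Kᗮ, Q x ∈ Kᗮ := by
    intro x hx y hy
    rw [← ContinuousLinearMap.adjoint_inner_left,
      IsResolventAt.adjoint_eq (isFormalAdjoint_self hT) hQ hR]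
    exact hx _ (h _ R hI' hR y hy)
  refine hQ.commutesUpTo_one_iff.mpr (Commute.symm ?_)
  rw [ContinuousLinearMap.IsIdempotentElem.commute_iff K.isIdempotentElem_starProjection,
    Submodule.range_starProjection, Submodule.ker_starProjection]
  exact ⟨h _ Q hI hQ, horthogonal⟩

variable [K.HasOrthogonalProjection]

theorem apply_mem (hK : Reduces K T) (x : T.domain) (hx : (x : H) ∈ K) : T x ∈ K := by
  obtain ⟨hPx, hTPx⟩ := hK x
  have hTx : T x = K.starProjection (T x) := by
    simpa only [one_smul, K.starProjection_eq_self_iff.mpr hx] using hTPx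
  exact K.starProjection_eq_self_iff.mp hTx.symm

theorem resolvent_mem (hK : Reduces K T) {z : ℂ} {R : H →L[ℂ] H} (hR : IsResolventAt T z R) {x : H}
    (hx : x ∈ K) : R x ∈ K := by
  have hcomm : R (K.starProjection x) = K.starProjection (R x) :=
    DFunLike.congr_fun (hR.commutesUpTo_one_iff.mp hK).eq x
  rw [K.starProjection_eq_self_iff.mpr hx] at hcomm
  exact K.starProjection_eq_self_iff.mp hcomm.symm

theorem dense_comap_domain (hK : Reduces K T) (hT : Dense (T.domain : Set H)) :
    Dense (T.domain.comap K.subtype : Set K) :=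
  dense_comap_subtype_of_starProjection_mem hT fun x hx => (hK ⟨x, hx⟩).1

theorem isSelfAdjoint_restriction [CompleteSpace H] [CompleteSpace K] (hK : Reduces K T)
    (hT : IsSelfAdjoint T) : IsSelfAdjoint (restriction K T hK.apply_mem) := by
  refine isSelfAdjoint_of_forall_mem_domain (hK.dense_comap_domain hT.dense_domain)
    (fun x y => isFormalAdjoint_self hT ⟨x, x.2⟩ ⟨y, y.2⟩) fun y w h => ?_
  refine (exists_apply_eq_of_forall_inner_eq hT (y := y) (w := w) fun x => ?_).1
  have hfix (u : K) : K.starProjection u = u := K.starProjection_eq_self_iff.mpr u.2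
  obtain ⟨hPx, hTPx⟩ := hK x
  calc ⟪(w : H), x⟫_ℂ = ⟪(w : H), K.starProjection x⟫_ℂ := by
        rw [← K.inner_starProjection_left_eq_right, hfix]
    _ = ⟪(y : H), T ⟨K.starProjection x, hPx⟩⟫_ℂ := h ⟨K.orthogonalProjectionOnto x, hPx⟩
    _ = ⟪(y : H), T x⟫_ℂ := by
        rw [hTPx, one_smul, ← K.inner_starProjection_left_eq_right, hfix]

theorem hasCompactResolvent_restriction [CompleteSpace K] (hK : Reduces K T)
    (hT : HasCompactResolvent T) : HasCompactResolvent (restriction K T hK.apply_mem) := by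
  intro z hz
  obtain ⟨R, hR, hRc⟩ := hT z hz
  have hRK : ∀ x ∈ K, R x ∈ K := fun _ => hK.resolvent_mem hR
  refine ⟨R.restrict hRK, ⟨fun x => ?_, fun y => Subtype.ext (hR.2 ⟨y, y.2⟩)⟩,
    IsCompactOperator.restrict' (f := (R : H →ₗ[ℂ] H)) hRc hRK⟩
  obtain ⟨hmem, hx⟩ := hR.1 x
  exact ⟨hmem, Subtype.ext hx⟩

variable {X Y : H →L[ℂ] H}

theorem commutator_apply_mem [CompleteSpace K] (hK : Reduces K T) (hT : Dense (T.domain : Set H))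
    (hX : ∀ x ∈ K, X x ∈ K) (hY : IsCommutator T X Y) {x : H} (hx : x ∈ K) : Y x ∈ K := by
  have hclosed : IsClosed (K : Set H) := (completeSpace_coe_iff_isComplete.mp ‹_›).isClosed
  refine apply_mem_of_dense hclosed (hK.dense_comap_domain hT) Y (fun y hy hyK => ?_) hx
  obtain ⟨hXy, hYy⟩ := hY ⟨y, hy⟩
  rw [hYy]
  exact K.sub_mem (hK.apply_mem _ (hX y hyK)) (hX _ (hK.apply_mem ⟨y, hy⟩ hyK))

end Reduces

theorem IsCommutator.restrict {X Y : H →L[ℂ] H} (hY : IsCommutator T X Y)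
    (hT : ∀ x : T.domain, (x : H) ∈ K → T x ∈ K) (hX : ∀ x ∈ K, X x ∈ K) (hYK : ∀ x ∈ K, Y x ∈ K) :
    IsCommutator (restriction K T hT) (X.restrict hX) (Y.restrict hYK) := by
  intro x
  obtain ⟨hmem, hYx⟩ := hY ⟨x, x.2⟩
  exact ⟨hmem, Subtype.ext hYx⟩

end Reduction

section BoundedDifference

variable {H : Type*} [NormedAddCommGroup H] [InnerProductSpace ℂ H]
variable {K : Submodule ℂ H} {S T : H →ₗ.[ℂ] H} {Z : H →L[ℂ] H}

theorem mem_domain_iff_of_domRestrict_eq_vadd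
    (h : S.domRestrict K = (Z : H →ₗ[ℂ] H) +ᵥ T.domRestrict K) {x : H} (hx : x ∈ K) :
    x ∈ S.domain ↔ x ∈ T.domain := by
  have hdom : K ⊓ S.domain = K ⊓ T.domain := congrArg LinearPMap.domain h
  simpa only [Submodule.mem_inf, hx, true_and] using SetLike.ext_iff.mp hdom x

theorem apply_eq_of_domRestrict_eq_vadd
    (h : S.domRestrict K = (Z : H →ₗ[ℂ] H) +ᵥ T.domRestrict K) {x : H} (hx : x ∈ K)
    (hxS : x ∈ S.domain) (hxT : x ∈ T.domain) : S ⟨x, hxS⟩ = Z x + T ⟨x, hxT⟩ :=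
  (LinearPMap.ext_iff.mp h).2 (x := x) (hf := ⟨hx, hxS⟩) (hg := ⟨hx, hxT⟩)

theorem apply_mem_of_domRestrict_eq_vadd (hK : IsClosed (K : Set H))
    (hd : Dense (T.domain.comap K.subtype : Set K))
    (hS : ∀ x : S.domain, (x : H) ∈ K → S x ∈ K) (hT : ∀ x : T.domain, (x : H) ∈ K → T x ∈ K)
    (h : S.domRestrict K = (Z : H →ₗ[ℂ] H) +ᵥ T.domRestrict K) {x : H} (hx : x ∈ K) : Z x ∈ K := by
  refine apply_mem_of_dense hK hd Z (fun y hyT hy => ?_) hx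
  have hyS := (mem_domain_iff_of_domRestrict_eq_vadd h hy).mpr hyT
  rw [← sub_eq_of_eq_add (apply_eq_of_domRestrict_eq_vadd h hy hyS hyT)]
  exact K.sub_mem (hS ⟨y, hyS⟩ hy) (hT ⟨y, hyT⟩ hy)

theorem isSelfAdjoint_restrict_of_domRestrict_eq_vadd [CompleteSpace K]
    (hd : Dense (T.domain.comap K.subtype : Set K)) (hS : S.IsFormalAdjoint S)
    (hT : T.IsFormalAdjoint T) (h : S.domRestrict K = (Z : H →ₗ[ℂ] H) +ᵥ T.domRestrict K)
    (hZ : ∀ x ∈ K, Z x ∈ K) : IsSelfAdjoint (Z.restrict hZ) := by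
  refine isSelfAdjoint_of_forall_inner_eq_of_dense hd fun x hxT y hyT => ?_
  have hdom (u : K) (hu : (u : H) ∈ T.domain) :=
    (mem_domain_iff_of_domRestrict_eq_vadd h u.2).mpr hu
  have hZ_eq (u : K) (hu : (u : H) ∈ T.domain) : Z u = S ⟨u, hdom u hu⟩ - T ⟨u, hu⟩ :=
    (sub_eq_of_eq_add (apply_eq_of_domRestrict_eq_vadd h u.2 (hdom u hu) hu)).symm
  change ⟪Z x, (y : H)⟫_ℂ = ⟪(x : H), Z y⟫_ℂ
  rw [hZ_eq x hxT, hZ_eq y hyT, inner_sub_left, inner_sub_right, hT ⟨x, hxT⟩ ⟨y, hyT⟩,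
    hS ⟨x, hdom x hxT⟩ ⟨y, hdom y hyT⟩]

theorem isRestriction_vadd_of_domRestrict_eq_vadd
    (hT : ∀ x : T.domain, (x : H) ∈ K → T x ∈ K)
    (h : S.domRestrict K = (Z : H →ₗ[ℂ] H) +ᵥ T.domRestrict K) (hZ : ∀ x ∈ K, Z x ∈ K) :
    IsRestriction K S ((Z.restrict hZ : K →ₗ[ℂ] K) +ᵥ restriction K T hT) :=
  ⟨fun x => (mem_domain_iff_of_domRestrict_eq_vadd h x.2).symm, fun x hxS =>
    (apply_eq_of_domRestrict_eq_vadd h x.1.2 hxS x.2).symm⟩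

end BoundedDifference

section Horizontal

variable {H : Type*} [NormedAddCommGroup H] [InnerProductSpace ℂ H]
variable {n : ℕ} {D : H →ₗ.[ℂ] H} {Γ : H →L[ℂ] H}

theorem horizontalOperator_apply (hΓ : Γ * Γ = 1) {x : H} (hx : x ∈ D.domain)
    (hΓx : Γ x ∈ D.domain) :
    horizontalOperator n D Γ ⟨x, hx, hΓx⟩ =
      (1 / 2 : ℂ) • (D ⟨x, hx⟩ + (-1 : ℂ) ^ n • Γ (D ⟨Γ x, hΓx⟩)) := by
  have hsq (y : H) : Γ (Γ y) = y := DFunLike.congr_fun hΓ y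
  change (1 / 2 : ℂ) • Γ (Γ (D ⟨x, hx⟩) + (-1 : ℂ) ^ n • D ⟨Γ x, hΓx⟩) = _
  rw [map_add, map_smul, hsq]

theorem isFormalAdjoint_horizontalOperator [CompleteSpace H] (hD : D.IsFormalAdjoint D)
    (hΓ : Γ * Γ = 1) (hΓs : IsSelfAdjoint Γ) :
    (horizontalOperator n D Γ).IsFormalAdjoint (horizontalOperator n D Γ) := by
  rintro ⟨x, hx, hΓx⟩ ⟨y, hy, hΓy⟩
  have hsymm (u v : H) : ⟪Γ u, v⟫_ℂ = ⟪u, Γ v⟫_ℂ := hΓs.isSymmetric u v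
  have hDxy : ⟪D ⟨x, hx⟩, y⟫_ℂ = ⟪x, D ⟨y, hy⟩⟫_ℂ := hD ⟨x, hx⟩ ⟨y, hy⟩
  have hDΓxy : ⟪Γ (D ⟨Γ x, hΓx⟩), y⟫_ℂ = ⟪x, Γ (D ⟨Γ y, hΓy⟩)⟫_ℂ := by
    rw [hsymm, ← hsymm x]
    exact hD ⟨Γ x, hΓx⟩ ⟨Γ y, hΓy⟩
  rw [horizontalOperator_apply hΓ hx hΓx, horizontalOperator_apply hΓ hy hΓy, inner_smul_left,
    inner_smul_right, inner_add_left, inner_add_right, inner_smul_left, inner_smul_right, hDxy,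
    hDΓxy]
  simp [Complex.conj_ofNat]

theorem horizontalOperator_apply_mem {K : Submodule ℂ H} (hΓ : Γ * Γ = 1)
    (hΓK : ∀ x ∈ K, Γ x ∈ K) (hDK : ∀ x : D.domain, (x : H) ∈ K → D x ∈ K)
    (x : (horizontalOperator n D Γ).domain) (hx : (x : H) ∈ K) :
    horizontalOperator n D Γ x ∈ K := by
  obtain ⟨x, hxD, hΓx⟩ := x
  rw [horizontalOperator_apply hΓ hxD hΓx]
  exact K.smul_mem _ (K.add_mem (hDK ⟨x, hxD⟩ hx)
    (K.smul_mem _ (hΓK _ (hDK ⟨Γ x, hΓx⟩ (hΓK x hx)))))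

end Horizontal

section Antiunitary

variable {E F : Type*} [NormedAddCommGroup E] [InnerProductSpace ℂ E]
variable [NormedAddCommGroup F] [InnerProductSpace ℂ F]

theorem inner_map_map_of_conjLinear (J : E →ₗᵢ⋆[ℂ] F) (x y : E) : ⟪J x, J y⟫_ℂ = ⟪y, x⟫_ℂ := by
  have hnorm (c : ℂ) : ‖J x + conj c • J y‖ = ‖x + c • y‖ := by
    rw [← J.map_smulₛₗ, ← map_add, J.norm_map]
  have h_add : ‖J x + J y‖ = ‖x + y‖ := by simpa using hnorm 1
  have h_sub : ‖J x - J y‖ = ‖x - y‖ := by simpa [← sub_eq_add_neg] using hnorm (-1)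
  have h_sub_I : ‖J x - Complex.I • J y‖ = ‖x + Complex.I • y‖ := by
    simpa [← sub_eq_add_neg] using hnorm Complex.I
  have h_add_I : ‖J x + Complex.I • J y‖ = ‖x - Complex.I • y‖ := by
    simpa [← sub_eq_add_neg] using hnorm (-Complex.I)
  rw [← inner_conj_symm y x, inner_eq_sum_norm_sq_div_four (𝕜 := ℂ) (J x),
    inner_eq_sum_norm_sq_div_four (𝕜 := ℂ) x]
  simp only [RCLike.I_to_complex, h_add, h_sub, h_sub_I, h_add_I]
  simp [Complex.conj_ofNat]
  ring

/-- The restriction of an antiunitary operator `J` to a subspace `K` with `J K = K`. -/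
def restrictAntiunitary (J : E ≃ₗᵢ⋆[ℂ] E) (K : Submodule ℂ E) (h : ∀ x, J x ∈ K ↔ x ∈ K) :
    K ≃ₗᵢ⋆[ℂ] K where
  toFun x := ⟨J x, (h x).mpr x.2⟩
  invFun x := ⟨J.symm x, (h _).mp (by simp only [J.apply_symm_apply, x.2])⟩
  map_add' _ _ := Subtype.ext (map_add J _ _)
  map_smul' c _ := Subtype.ext (J.map_smulₛₗ c _)
  left_inv _ := Subtype.ext (J.symm_apply_apply _)
  right_inv _ := Subtype.ext (J.apply_symm_apply _)
  norm_map' _ := J.norm_map _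

end Antiunitary

section Representation

variable {A : Type*} [Ring A] [StarRing A] [Algebra ℂ A]
variable {H : Type*} [NormedAddCommGroup H] [InnerProductSpace ℂ H] [CompleteSpace H]

theorem inner_apply_left (π : A →⋆ₐ[ℂ] (H →L[ℂ] H)) (a : A) (x y : H) :
    ⟪π a x, y⟫_ℂ = ⟪x, π (star a) y⟫_ℂ := by
  rw [map_star, ContinuousLinearMap.star_eq_adjoint, ContinuousLinearMap.adjoint_inner_right]

variable [StarModule ℂ A]

/-- The `*`-representation `b ↦ J b* J⁻¹` of the opposite algebra. -/
def oppositeRepresentation (π : A →⋆ₐ[ℂ] (H →L[ℂ] H)) (J : H ≃ₗᵢ⋆[ℂ] H) :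
    Aᵐᵒᵖ →⋆ₐ[ℂ] (H →L[ℂ] H) where
  toFun b := oppositeAction π J b.unop
  map_one' := by
    ext x
    simp
  map_mul' a b := by
    ext x
    simp
  map_zero' := by
    ext x
    simp
  map_add' a b := by
    ext x
    simp
  commutes' r := by
    ext x
    simp [Algebra.algebraMap_eq_smul_one, star_smul, J.map_smulₛₗ]
  map_star' a := by
    have hJ (u v : H) : ⟪J u, J v⟫_ℂ = ⟪v, u⟫_ℂ :=
      inner_map_map_of_conjLinear J.toLinearIsometry u v
    refine (ContinuousLinearMap.eq_adjoint_iff _ _).mpr fun x y => ?_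
    obtain ⟨u, rfl⟩ := J.surjective x
    obtain ⟨v, rfl⟩ := J.surjective y
    simp only [oppositeAction_apply, MulOpposite.unop_star, J.symm_apply_apply, hJ,
      inner_apply_left π (star a.unop)]

/-- The restriction of a `*`-representation to a `*`-subalgebra `B` and a closed subspace that is
invariant under `B`. -/
def restrictRepresentation (π : A →⋆ₐ[ℂ] (H →L[ℂ] H)) (B : StarSubalgebra ℂ A)
    (K : Submodule ℂ H) [CompleteSpace K] (hK : ∀ b ∈ B, ∀ x ∈ K, π b x ∈ K) :
    B →⋆ₐ[ℂ] (K →L[ℂ] K) where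
  toFun b := (π b).restrict (hK b b.2)
  map_one' := by
    ext x
    simp
  map_mul' a b := by
    ext x
    simp
  map_zero' := by
    ext x
    simp
  map_add' a b := by
    ext x
    simp
  commutes' r := by
    ext x
    simp [Algebra.algebraMap_eq_smul_one]
  map_star' b := by
    refine (ContinuousLinearMap.eq_adjoint_iff _ _).mpr fun x y => ?_
    change ⟪π (star (b : A)) x, (y : H)⟫_ℂ = ⟪(x : H), π b y⟫_ℂ
    rw [inner_apply_left, star_star]

end Representation

namespace SpectralTriple

variable {A : Type*} [Ring A] [StarRing A] [Algebra ℂ A]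
variable {H : Type*} [NormedAddCommGroup H] [InnerProductSpace ℂ H] [CompleteSpace H]

/-- The restriction of a spectral triple `(A, H, D)` to a `*`-subalgebra `B` of `A` and a closed
subspace that is invariant under `B` and reduces `D`. -/
def restrict [StarModule ℂ A] (T : SpectralTriple A H) (B : StarSubalgebra ℂ A) (K : Submodule ℂ H)
    [CompleteSpace K] (hB : ∀ b ∈ B, ∀ x ∈ K, T.π b x ∈ K) (hK : Reduces K T.D) :
    SpectralTriple B K where
  π := restrictRepresentation T.π B K hB
  D := restriction K T.D hK.apply_mem
  isSelfAdjoint := hK.isSelfAdjoint_restriction T.isSelfAdjoint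
  hasCompactResolvent := hK.hasCompactResolvent_restriction T.hasCompactResolvent
  bounded_commutator b := by
    obtain ⟨X, hX⟩ := T.bounded_commutator b
    exact ⟨_, hX.restrict hK.apply_mem (hB b b.2) fun _ =>
      hK.commutator_apply_mem T.isSelfAdjoint.dense_domain (hB b b.2) hX⟩

/-- The spectral triple `(A, H, D + V)`, for a bounded self-adjoint operator `V` that commutes with
`A`. -/
def perturb (T : SpectralTriple A H) (V : H →L[ℂ] H) (hV : IsSelfAdjoint V)
    (hVπ : ∀ a, Commute V (T.π a)) : SpectralTriple A H where
  π := T.π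
  D := (V : H →ₗ[ℂ] H) +ᵥ T.D
  isSelfAdjoint := isSelfAdjoint_vadd hV T.isSelfAdjoint
  hasCompactResolvent := hasCompactResolvent_vadd hV T.isSelfAdjoint T.hasCompactResolvent
  bounded_commutator a := by
    simpa only [isCommutator_vadd_iff (hVπ a)] using T.bounded_commutator a

end SpectralTriple

namespace EquivariantTriple

variable {A : Type*} [Ring A] [StarRing A] [Algebra ℂ A] {n : ℕ}
variable {𝒜 : (Fin n → ℤ) → Submodule ℂ A} [GradedAlgebra 𝒜]
variable {H : Type*} [NormedAddCommGroup H] [InnerProductSpace ℂ H] [CompleteSpace H]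
variable {d : ℤ} (T : EquivariantTriple 𝒜 H d)

theorem mem_zeroEigenspace_iff {x : H} : x ∈ T.zeroEigenspace ↔ ∀ j, x ∈ kernel (T.δ j) :=
  Submodule.mem_iInf _

variable {T} in
theorem apply_mem_zeroEigenspace {c : ℂ} {X : H →L[ℂ] H} (hX : ∀ j, CommutesUpTo c (T.δ j) X)
    {x : H} (hx : x ∈ T.zeroEigenspace) : X x ∈ T.zeroEigenspace :=
  T.mem_zeroEigenspace_iff.mpr fun j => (hX j).apply_mem_kernel (T.mem_zeroEigenspace_iff.mp hx j)

theorem π_mem_zeroEigenspace {a : A} (ha : a ∈ 𝒜 0) {x : H} (hx : x ∈ T.zeroEigenspace) :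
    T.π a x ∈ T.zeroEigenspace := by
  rw [mem_zeroEigenspace_iff] at hx ⊢
  intro j
  obtain ⟨hax, hleibniz⟩ := T.δ_leibniz a x (fun i => (hx i).1) j
  have hδa : derivation 𝒜 j a = 0 := by simp [derivation_of_mem 𝒜 j ha]
  exact ⟨hax, by rw [hleibniz, hδa, (hx j).2, map_zero, map_zero, zero_apply, add_zero]⟩

theorem J_mem_zeroEigenspace {x : H} (hx : x ∈ T.zeroEigenspace) : T.J x ∈ T.zeroEigenspace := by
  rw [mem_zeroEigenspace_iff] at hx ⊢
  intro j
  obtain ⟨hxδ, hδx⟩ := hx j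
  obtain ⟨hJx, hδJ⟩ := T.δ_J j ⟨x, hxδ⟩
  rw [hδx, map_zero, add_zero] at hδJ
  exact ⟨hJx, hδJ⟩

theorem J_mem_zeroEigenspace_iff (x : H) : T.J x ∈ T.zeroEigenspace ↔ x ∈ T.zeroEigenspace := by
  have hsign : signJSq d ≠ 0 := by
    unfold signJSq
    split_ifs <;> norm_num
  refine ⟨fun h => ?_, T.J_mem_zeroEigenspace⟩
  have hJJ := T.J_mem_zeroEigenspace h
  rwa [T.J_sq, Submodule.smul_mem_iff _ hsign] at hJJ

theorem reduces_zeroEigenspace : Reduces T.zeroEigenspace T.D :=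
  Reduces.of_resolvent_mem T.isSelfAdjoint fun _ _ _ hR _ => apply_mem_zeroEigenspace fun j =>
    (T.δ_D j).commutesUpTo_resolvent (T.δ_isSelfAdjoint j) hR

theorem isFormalAdjoint_horizontalDirac {Γ : H →L[ℂ] H} (hΓ : Γ * Γ = 1) (hΓs : IsSelfAdjoint Γ) :
    (T.horizontalDirac Γ).IsFormalAdjoint (T.horizontalDirac Γ) :=
  isFormalAdjoint_horizontalOperator (isFormalAdjoint_self T.isSelfAdjoint) hΓ hΓs

theorem horizontalDirac_mem_zeroEigenspace {Γ : H →L[ℂ] H} (hΓ : Γ * Γ = 1)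
    (hΓδ : ∀ j, CommutesUpTo 1 (T.δ j) Γ) (x : (T.horizontalDirac Γ).domain)
    (hx : (x : H) ∈ T.zeroEigenspace) : T.horizontalDirac Γ x ∈ T.zeroEigenspace :=
  horizontalOperator_apply_mem hΓ (fun _ => apply_mem_zeroEigenspace hΓδ)
    T.reduces_zeroEigenspace.apply_mem x hx

/-- The antiunitary operator that `J` induces on `H₀`. -/
def invariantJ : T.zeroEigenspace ≃ₗᵢ⋆[ℂ] T.zeroEigenspace :=
  restrictAntiunitary T.J T.zeroEigenspace T.J_mem_zeroEigenspace_iff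

variable [StarModule ℂ A] [StarCompatible 𝒜]

/-- The spectral triple that `(A, H, D)` induces for the invariant subalgebra on `H₀`.  Its Dirac
operator is the restriction of the whole of `D`, not only of its horizontal part. -/
def invariantTriple : SpectralTriple (invariantSubalgebra 𝒜) T.zeroEigenspace :=
  T.restrict (invariantSubalgebra 𝒜) T.zeroEigenspace (fun _ ha _ => T.π_mem_zeroEigenspace ha)
    T.reduces_zeroEigenspace

theorem commute_oppositeAction_invariantTriple (b c : invariantSubalgebra 𝒜) :
    Commute (T.invariantTriple.π b) (oppositeAction T.invariantTriple.π T.invariantJ c) := by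
  ext x
  exact DFunLike.congr_fun (T.commutant b c).eq (x : H)

theorem first_order_invariantTriple (b c : invariantSubalgebra 𝒜)
    (X : T.zeroEigenspace →L[ℂ] T.zeroEigenspace)
    (hX : IsCommutator T.invariantTriple.D (T.invariantTriple.π b) X) :
    Commute X (oppositeAction T.invariantTriple.π T.invariantJ c) := by
  obtain ⟨Y, hY⟩ := T.bounded_commutator b
  have hb : ∀ x ∈ T.zeroEigenspace, T.π b x ∈ T.zeroEigenspace := fun _ =>
    T.π_mem_zeroEigenspace b.2
  have hYK : ∀ x ∈ T.zeroEigenspace, Y x ∈ T.zeroEigenspace := fun _ =>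
    T.reduces_zeroEigenspace.commutator_apply_mem T.isSelfAdjoint.dense_domain hb hY
  obtain rfl : X = Y.restrict hYK := hX.unique T.invariantTriple.isSelfAdjoint.dense_domain
    (hY.restrict T.reduces_zeroEigenspace.apply_mem hb hYK)
  ext x
  exact DFunLike.congr_fun (T.first_order b c Y hY).eq (x : H)

theorem exists_isSelfAdjoint_isRestriction {S : H →ₗ.[ℂ] H} (hS : S.IsFormalAdjoint S)
    (hSK : ∀ x : S.domain, (x : H) ∈ T.zeroEigenspace → S x ∈ T.zeroEigenspace)
    {Z : H →L[ℂ] H} (hZ : ∀ a ∈ 𝒜 0, Commute Z (T.π a))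
    (hD : S.domRestrict T.zeroEigenspace = (Z : H →ₗ[ℂ] H) +ᵥ T.D.domRestrict T.zeroEigenspace) :
    ∃ V : T.zeroEigenspace →L[ℂ] T.zeroEigenspace, IsSelfAdjoint V ∧
      (∀ b, Commute V (T.invariantTriple.π b)) ∧
      IsRestriction T.zeroEigenspace S
        ((V : T.zeroEigenspace →ₗ[ℂ] T.zeroEigenspace) +ᵥ T.invariantTriple.D) := by
  have hTK := T.reduces_zeroEigenspace.apply_mem
  have hd := T.reduces_zeroEigenspace.dense_comap_domain T.isSelfAdjoint.dense_domain
  have hZK : ∀ x ∈ T.zeroEigenspace, Z x ∈ T.zeroEigenspace := fun _ =>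
    apply_mem_of_domRestrict_eq_vadd T.isClosed_zeroEigenspace hd hSK hTK hD
  refine ⟨Z.restrict hZK, ?_, fun b => ?_, isRestriction_vadd_of_domRestrict_eq_vadd hTK hD hZK⟩
  · exact isSelfAdjoint_restrict_of_domRestrict_eq_vadd hd hS
      (isFormalAdjoint_self T.isSelfAdjoint) hD hZK
  · ext x
    exact DFunLike.congr_fun (hZ b b.2).eq (x : H)

end EquivariantTriple

section IsometricFibres

variable {A : Type*} [Ring A] [StarRing A] [Algebra ℂ A] {n : ℕ}
variable {𝒜 : (Fin n → ℤ) → Submodule ℂ A} [GradedAlgebra 𝒜]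
variable {H : Type*} [NormedAddCommGroup H] [InnerProductSpace ℂ H] [CompleteSpace H]
variable {d : ℤ} {T : EquivariantTriple 𝒜 H d} {Γ : H →L[ℂ] H}

theorem HasIsometricFibres.exists_domRestrict_eq (h : HasIsometricFibres T Γ) :
    ∃ Z : H →L[ℂ] H, (∀ a, Commute Z (T.π a)) ∧
      (T.horizontalDirac Γ).domRestrict T.zeroEigenspace =
        (Z : H →ₗ[ℂ] H) +ᵥ T.D.domRestrict T.zeroEigenspace := by
  obtain ⟨Dv, Z, _, hD, hDv, -, -, hZ, -, -⟩ := h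
  have decomposition {x : H} (hx : x ∈ T.D.domain) : ∃ (hxv : x ∈ Dv.domain)
      (hxh : x ∈ (T.horizontalDirac Γ).domain),
      T.D ⟨x, hx⟩ = Dv ⟨x, hxv⟩ + T.horizontalDirac Γ ⟨x, hxh⟩ + Z x := by
    have hx' := hx
    rw [hD] at hx'
    exact ⟨hx'.1.1, hx'.1.2, (LinearPMap.ext_iff.mp hD).2 (x := x) (hf := hx) (hg := hx')⟩
  refine ⟨-Z, fun a => (hZ a).neg_left, LinearPMap.ext ?_ ?_⟩
  · refine le_antisymm (fun x hx => ⟨hx.1, hx.2.1⟩) fun x hx => ?_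
    obtain ⟨-, hxh, -⟩ := decomposition hx.2
    exact ⟨hx.1, hxh⟩
  · intro x hxh hx
    obtain ⟨hxv, hxh', hDx⟩ := decomposition hx.2
    rw [hDv ⟨x, hxv⟩ hx.1, zero_add] at hDx
    change T.horizontalDirac Γ ⟨x, hxh'⟩ = -Z x + T.D ⟨x, hx.2⟩
    rw [hDx, add_comm, add_neg_cancel_right]

end IsometricFibres

end TorusBundle

end

open TorusBundle in
theorem mainTheorem1_general
    {A : Type*} [Ring A] [StarRing A] [Algebra ℂ A] [StarModule ℂ A]
    {n : ℕ} (𝒜 : (Fin n → ℤ) → Submodule ℂ A) [GradedAlgebra 𝒜] [StarCompatible 𝒜]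
    {H : Type*} [NormedAddCommGroup H] [InnerProductSpace ℂ H] [CompleteSpace H]
    {d : ℤ} (T : EquivariantTriple 𝒜 H d) (S : H →ₗ.[ℂ] H) (hS : S.IsFormalAdjoint S)
    (hSK : ∀ x : S.domain, (x : H) ∈ T.zeroEigenspace → S x ∈ T.zeroEigenspace)
    (Z : H →L[ℂ] H) (hZ : ∀ a ∈ 𝒜 0, Commute Z (T.π a))
    (hD : S.domRestrict T.zeroEigenspace = (Z : H →ₗ[ℂ] H) +ᵥ T.D.domRestrict T.zeroEigenspace) :
    ∃ (T₀ : SpectralTriple (invariantSubalgebra 𝒜) T.zeroEigenspace)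
      (J₀ : T.zeroEigenspace ≃ₗᵢ⋆[ℂ] T.zeroEigenspace)
      (ρ : (invariantSubalgebra 𝒜)ᵐᵒᵖ →⋆ₐ[ℂ] (T.zeroEigenspace →L[ℂ] T.zeroEigenspace)),
      (∀ (b : invariantSubalgebra 𝒜) (h : T.zeroEigenspace), (T₀.π b h : H) = T.π b h) ∧
      IsRestriction T.zeroEigenspace S T₀.D ∧
      (∀ h : T.zeroEigenspace, (J₀ h : H) = T.J h) ∧
      (∀ b : invariantSubalgebra 𝒜, ρ (MulOpposite.op b) = oppositeAction T₀.π J₀ b) ∧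
      (∀ b c : invariantSubalgebra 𝒜, Commute (T₀.π b) (oppositeAction T₀.π J₀ c)) ∧
      (∀ (b c : invariantSubalgebra 𝒜) (X : T.zeroEigenspace →L[ℂ] T.zeroEigenspace),
        IsCommutator T₀.D (T₀.π b) X → Commute X (oppositeAction T₀.π J₀ c)) := by
  obtain ⟨V, hV, hVπ, hSV⟩ := T.exists_isSelfAdjoint_isRestriction hS hSK hZ hD
  refine ⟨T.invariantTriple.perturb V hV hVπ, T.invariantJ,
    oppositeRepresentation T.invariantTriple.π T.invariantJ, fun _ _ => rfl, hSV, fun _ => rfl,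
    fun _ => rfl, T.commute_oppositeAction_invariantTriple, fun b c X hX => ?_⟩
  exact T.first_order_invariantTriple b c X ((isCommutator_vadd_iff (hVπ b)).mp hX)

theorem mainTheorem1
    {A : Type*} [Ring A] [StarRing A] [Algebra ℂ A] [StarModule ℂ A]
    {n : ℕ} (𝒜 : (Fin n → ℤ) → Submodule ℂ A) [GradedAlgebra 𝒜] [TorusBundle.StarCompatible 𝒜]
    {H : Type*} [NormedAddCommGroup H] [InnerProductSpace ℂ H] [CompleteSpace H]
    (m : ℤ) (T : TorusBundle.EquivariantTriple 𝒜 H (n + m)) (Γ : H →L[ℂ] H)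
    (hΓ : TorusBundle.IsProjectable T Γ) (hT : TorusBundle.HasIsometricFibres T Γ) :
    ∃ (T₀ : TorusBundle.SpectralTriple (TorusBundle.invariantSubalgebra 𝒜) T.zeroEigenspace)
      (J₀ : T.zeroEigenspace ≃ₗᵢ⋆[ℂ] T.zeroEigenspace)
      (ρ : (TorusBundle.invariantSubalgebra 𝒜)ᵐᵒᵖ →⋆ₐ[ℂ]
        (T.zeroEigenspace →L[ℂ] T.zeroEigenspace)),
      -- `B` acts on `H₀` by restriction, `D₀` is the restriction of `D_h`, `J₀` that of `J`
      (∀ (b : TorusBundle.invariantSubalgebra 𝒜) (h : T.zeroEigenspace),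
        (T₀.π b h : H) = T.π (b : A) (h : H)) ∧
      TorusBundle.IsRestriction T.zeroEigenspace (T.horizontalDirac Γ) T₀.D ∧
      (∀ h : T.zeroEigenspace, (J₀ h : H) = T.J (h : H)) ∧
      -- the action of the opposite algebra
      (∀ b : TorusBundle.invariantSubalgebra 𝒜,
        ρ (MulOpposite.op b) = TorusBundle.oppositeAction T₀.π J₀ b) ∧
      -- `J₀` maps `B` into its commutant
      (∀ b c : TorusBundle.invariantSubalgebra 𝒜,
        Commute (T₀.π b) (TorusBundle.oppositeAction T₀.π J₀ c)) ∧
      -- the first-order condition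
      (∀ (b c : TorusBundle.invariantSubalgebra 𝒜)
        (X : T.zeroEigenspace →L[ℂ] T.zeroEigenspace),
        TorusBundle.IsCommutator T₀.D (T₀.π b) X →
          Commute X (TorusBundle.oppositeAction T₀.π J₀ c)) := by
  obtain ⟨Z, hZ, hD⟩ := hT.exists_domRestrict_eq
  exact mainTheorem1_general 𝒜 T (T.horizontalDirac Γ)
    (T.isFormalAdjoint_horizontalDirac hΓ.sq hΓ.isSelfAdjoint)
    (T.horizontalDirac_mem_zeroEigenspace hΓ.sq hΓ.comm_δ) Z (fun a _ => hZ a) hD
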